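/- Let $n\ge 2$, $0<l<\infty$, and let $f$ be a real function that is $C^2$ on $[0,l)$ and $C^3$ at $t=0$, with $f(0)=f''(0)=0$, $f'(0)=1$ and $f>0$ on $(0,l)$. Let $M=[0,l)\times_f\mathbb S^{n-1}$ be the generalized space form (spherically symmetric manifold) with warping function $f$: the quotient of $[0,l)\times\mathbb S^{n-1}$ obtained by identifying all pairs $(0,\xi)$ with one point $q$ (the base point), with its smooth structure given by the normal coordinates $(t,\xi)\mapsto t\xi$ at $q$ and with the metric $dt^2+f(t)^2|d\xi|^2$, where $|d\xi|^2$ is the round metric of the unit sphere $\mathbb S^{n-1}\subset\mathbb R^n$. Let $B(q,r)$ be the geodesic ball of radius $r$ centred at $q$, and for $1<p<\infty$ let $$\lambda_{1,p}(\Omega)=\inf\left\{\frac{\int_\Omega|\nabla u|^p}{\int_\Omega|u|^p}\ :\ u\in W^{1,p}_0(\Omega),\ u\ne 0\right\}$$ be the first Dirichlet eigenvalue of the $p$-Laplacian on $\Omega$, where $W^{1,p}_0(\Omega)$ is the completion of $C_0^\infty(\Omega)$ under the norm $\left(\int_\Omega(|u|^p+|\nabla u|^p)\right)^{1/p}$.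 Assume that $M$ closes at $t=l$, i.e. that $f$ is also defined at $l$ and $f(l)=0$. (I) If $n=2$ and, for some $\epsilon>0$, $f\in C^1([0,l+\epsilon))$, then $\lim_{r\to l^-}\lambda_{1,p}(B(q,r))=0$ for every $1<p\le 2$. (II) If $n\ge 3$ and, for some $\epsilon>0$, $f\in C^2([0,l+\epsilon))$, then $\lim_{r\to l^-}\lambda_{1,p}(B(q,r))=0$ for every $1<p<3$. -/

import Mathlib

open Set Filter Topology MeasureTheory
open scoped ENNReal Matrix

noncomputable section

namespace SpaceForm

/-- The underlying manifold of the generalized space form `[0,l) ×_f S^{n-1}`, with all the pairs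
`(0, ξ)` identified with the base point `q`. It is described in its global normal coordinates at
`q`: the class of the pair `(t, ξ)` is the point `t • ξ`, so that `q` is the origin and the manifold
is the open ball of radius `l` in `ℝⁿ`, with its usual smooth structure. -/
def carrier (n : ℕ) (l : ℝ) : Set (EuclideanSpace ℝ (Fin n)) := Metric.ball 0 l

/-- The Riemannian metric `dt² + f(t)² |dξ|²` in the coordinates `x = t • ξ`: radial and tangential
directions are orthogonal, a radial vector keeps its Euclidean length, and a vector tangent to the
sphere of radius `t` has `f(t) / t` times its Euclidean length. At the base point it is the
Euclidean inner product. See `metric_polar`. -/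
def metric {n : ℕ} (f : ℝ → ℝ) (x v w : EuclideanSpace ℝ (Fin n)) : ℝ :=
  if x = 0 then inner ℝ v w
  else
    inner ℝ v (‖x‖⁻¹ • x) * inner ℝ w (‖x‖⁻¹ • x) +
      (f ‖x‖ / ‖x‖) ^ 2 *
        (inner ℝ v w - inner ℝ v (‖x‖⁻¹ • x) * inner ℝ w (‖x‖⁻¹ • x))

/-- The differential of `(t, ξ) ↦ t • ξ` at `(t, ξ)` sends `(a, η)`, where `a ∈ ℝ` and
`η ∈ T_ξ S^{n-1} = ξ^⊥`, to `a • ξ + t • η`. Thus `metric` pulls back to `dt² + f(t)² |dξ|²`. -/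
theorem metric_polar {n : ℕ} (f : ℝ → ℝ) {t : ℝ} (ht : 0 < t) {ξ η η' : EuclideanSpace ℝ (Fin n)}
    (hξ : ‖ξ‖ = 1) (hη : inner ℝ η ξ = 0) (hη' : inner ℝ η' ξ = 0) (a a' : ℝ) :
    metric f (t • ξ) (a • ξ + t • η) (a' • ξ + t • η') = a * a' + f t ^ 2 * inner ℝ η η' := by
  have hn : ‖t • ξ‖ = t := by rw [norm_smul, hξ, mul_one, Real.norm_of_nonneg ht.le]
  have h0 : t • ξ ≠ 0 := by rw [← norm_ne_zero_iff, hn]; exact ht.ne'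
  have hξξ : inner ℝ ξ ξ = (1 : ℝ) := by rw [real_inner_self_eq_norm_sq, hξ, one_pow]
  have hs : t⁻¹ • t • ξ = ξ := by rw [smul_smul, inv_mul_cancel₀ ht.ne', one_smul]
  have h3 : inner ℝ ξ η' = (0 : ℝ) := by rw [real_inner_comm, hη']
  rw [metric, if_neg h0, hn, hs]
  simp only [inner_add_left, inner_add_right, real_inner_smul_left, real_inner_smul_right, hη, hη',
    h3, hξξ]
  field_simp
  ring

/-- The matrix `(g_ij)` of the metric in the standard coordinates. -/
def metricMatrix {n : ℕ} (f : ℝ → ℝ) (x : EuclideanSpace ℝ (Fin n)) : Matrix (Fin n) (Fin n) ℝ :=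
  Matrix.of fun i j => metric f x (EuclideanSpace.single i 1) (EuclideanSpace.single j 1)

/-- The Riemannian volume measure `√(det g_ij) dx`. -/
def vol (n : ℕ) (f : ℝ → ℝ) : Measure (EuclideanSpace ℝ (Fin n)) :=
  volume.withDensity fun x => ENNReal.ofReal √(metricMatrix f x).det

/-- The length `(∑ g^ij α_i α_j)^{1/2}` of a covector `α` at `x`, where `(g^ij) = (g_ij)⁻¹`. For
`α = du` it is the length `|∇u|_g` of the Riemannian gradient of `u`. -/
def covectorNorm {n : ℕ} (f : ℝ → ℝ) (x : EuclideanSpace ℝ (Fin n))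
    (α : EuclideanSpace ℝ (Fin n) →L[ℝ] ℝ) : ℝ :=
  √((fun i => α (EuclideanSpace.single i 1)) ⬝ᵥ
      ((metricMatrix f x)⁻¹ *ᵥ fun i => α (EuclideanSpace.single i 1)))

/-- The length of a `C¹` curve defined on `[0, 1]`. -/
def curveLength {n : ℕ} (f : ℝ → ℝ) (γ : ℝ → EuclideanSpace ℝ (Fin n)) : ℝ≥0∞ :=
  ∫⁻ t in Icc (0 : ℝ) 1, ENNReal.ofReal
    √(metric f (γ t) (derivWithin γ (Icc 0 1) t) (derivWithin γ (Icc 0 1) t))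

/-- The Riemannian distance: the infimum of the lengths of the `C¹` curves in the manifold that
join the two points. -/
def riemDist {n : ℕ} (l : ℝ) (f : ℝ → ℝ) (x y : EuclideanSpace ℝ (Fin n)) : ℝ≥0∞ :=
  ⨅ (γ : ℝ → EuclideanSpace ℝ (Fin n)) (_ : ContDiffOn ℝ 1 γ (Icc 0 1)) (_ : γ 0 = x)
    (_ : γ 1 = y) (_ : ∀ t ∈ Icc (0 : ℝ) 1, γ t ∈ carrier n l), curveLength f γ

/-- The geodesic ball `B(q, r)` centred at the base point `q`. -/
def geodesicBall (n : ℕ) (l : ℝ) (f : ℝ → ℝ) (r : ℝ) : Set (EuclideanSpace ℝ (Fin n)) :=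
  {x | x ∈ carrier n l ∧ riemDist l f 0 x < ENNReal.ofReal r}

/-- `C_0^∞(Ω)`: smooth functions with compact support contained in `Ω`. -/
def IsTestFunction {n : ℕ} (Ω : Set (EuclideanSpace ℝ (Fin n)))
    (φ : EuclideanSpace ℝ (Fin n) → ℝ) : Prop :=
  ContDiff ℝ ((⊤ : ℕ∞) : WithTop ℕ∞) φ ∧ HasCompactSupport φ ∧ tsupport φ ⊆ Ω

/-- The `p`-th power `∫_Ω (|u|^p + |α|_g^p)` of the Sobolev norm of the pair formed by a function
`u` and a covector field `α` (the differential of `u`). -/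
def sobolevEnergy {n : ℕ} (f : ℝ → ℝ) (p : ℝ) (Ω : Set (EuclideanSpace ℝ (Fin n)))
    (u : EuclideanSpace ℝ (Fin n) → ℝ)
    (α : EuclideanSpace ℝ (Fin n) → EuclideanSpace ℝ (Fin n) →L[ℝ] ℝ) : ℝ≥0∞ :=
  ∫⁻ x in Ω, (ENNReal.ofReal (|u x| ^ p) + ENNReal.ofReal (covectorNorm f x (α x) ^ p)) ∂vol n f

/-- `u` belongs to `W_0^{1,p}(Ω)` and has weak differential `α`. The space is the completion of
`C_0^∞(Ω)` under the Sobolev norm, realised as the closure of the pairs `(φ, dφ)` with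
`φ ∈ C_0^∞(Ω)` among the pairs of a function and a covector field of class `L^p`. -/
def MemW0 {n : ℕ} (f : ℝ → ℝ) (p : ℝ) (Ω : Set (EuclideanSpace ℝ (Fin n)))
    (u : EuclideanSpace ℝ (Fin n) → ℝ)
    (α : EuclideanSpace ℝ (Fin n) → EuclideanSpace ℝ (Fin n) →L[ℝ] ℝ) : Prop :=
  AEStronglyMeasurable u ((vol n f).restrict Ω) ∧
  AEStronglyMeasurable α ((vol n f).restrict Ω) ∧
  sobolevEnergy f p Ω u α < ∞ ∧
  ∃ φ : ℕ → EuclideanSpace ℝ (Fin n) → ℝ, (∀ k, IsTestFunction Ω (φ k)) ∧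
    Tendsto
      (fun k => sobolevEnergy f p Ω (fun x => φ k x - u x) (fun x => fderiv ℝ (φ k) x - α x))
      atTop (𝓝 0)

/-- The first Dirichlet eigenvalue `λ_{1,p}(Ω)` of the `p`-Laplacian: the infimum of
`∫_Ω |∇u|^p / ∫_Ω |u|^p` over the non-zero `u ∈ W_0^{1,p}(Ω)`. -/
def firstEigenvalue {n : ℕ} (f : ℝ → ℝ) (p : ℝ) (Ω : Set (EuclideanSpace ℝ (Fin n))) : ℝ≥0∞ :=
  ⨅ (u : EuclideanSpace ℝ (Fin n) → ℝ)
    (α : EuclideanSpace ℝ (Fin n) → EuclideanSpace ℝ (Fin n) →L[ℝ] ℝ)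
    (_ : MemW0 f p Ω u α) (_ : ¬ u =ᵐ[(vol n f).restrict Ω] 0),
    (∫⁻ x in Ω, ENNReal.ofReal (covectorNorm f x (α x) ^ p) ∂vol n f) /
      ∫⁻ x in Ω, ENNReal.ofReal (|u x| ^ p) ∂vol n f

end SpaceForm

end

/-! A closing end reached at a Lipschitz rate has zero `p`-capacity when `p ≤ n`, so removing a
small neighbourhood of it costs almost no energy. Since `f` is `C¹` on `[0, l]` and vanishes at both
ends, `f t ≤ C * t` and `f t ≤ C * (l - t)`. Let `s = l - ‖x‖` and take a smoothed version of `log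
(s / a) / log (b / a)`, truncated to 0 for `s ≤ a` and to 1 for `s ≥ b`. Its gradient is at most `K
/ (s * L)` with `L = log (b / a)`, and the sphere at distance `s` from the end has area at most a
constant times `s ^ (n - 1)`. The energy is thus at most a constant times `L ^ (-p) * ∫ s ^ (n - 1 -
p) ds`; as `s ^ (n - p) ≤ l ^ (n - p)`, this is `O(L ^ (1 - p))`. The logarithm is what reaches the
critical case `p = n`.

The function is 1 on the ball of radius `l - b`, which bounds the denominator below. With `b` fixed
and `a → 0` as `r → l`, the quotient tends to 0. The energy bound is `lintegral_deriv_logCutoff_le`,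
the quotient bound `firstEigenvalue_geodesicBall_le`. -/

noncomputable section

namespace SpaceForm

/-! ### The metric in radial directions -/

section

variable {n : ℕ} {f : ℝ → ℝ} {l : ℝ} {x : EuclideanSpace ℝ (Fin n)}

/-- The coordinates of the unit radial vector at `x`. -/
def radialVec (x : EuclideanSpace ℝ (Fin n)) : Fin n → ℝ := fun i => ‖x‖⁻¹ * x i

theorem radialVec_dotProduct_self (hx : x ≠ 0) : radialVec x ⬝ᵥ radialVec x = 1 := by
  have h : ∑ i, x i * x i = ‖x‖ ^ 2 := by
    rw [EuclideanSpace.real_norm_sq_eq]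
    exact Finset.sum_congr rfl fun i _ => by ring
  have hn : ‖x‖ ≠ 0 := norm_ne_zero_iff.2 hx
  calc radialVec x ⬝ᵥ radialVec x = (‖x‖⁻¹) ^ 2 * ∑ i, x i * x i := by
        simp only [dotProduct, radialVec, Finset.mul_sum]
        exact Finset.sum_congr rfl fun i _ => by ring
    _ = 1 := by rw [h]; field_simp

/-- A rank-one perturbation of a scalar matrix: this form yields both the determinant and the radial
eigenvector. -/
theorem metricMatrix_eq (hx : x ≠ 0) :
    metricMatrix f x = (f ‖x‖ / ‖x‖) ^ 2 • (1 : Matrix (Fin n) (Fin n) ℝ) +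
      (1 - (f ‖x‖ / ‖x‖) ^ 2) • Matrix.vecMulVec (radialVec x) (radialVec x) := by
  ext i j
  simp only [metricMatrix, metric, if_neg hx, Matrix.of_apply, Matrix.add_apply, Matrix.smul_apply,
    Matrix.vecMulVec_apply, radialVec, Matrix.one_apply, smul_eq_mul, EuclideanSpace.inner_single_left,
    PiLp.smul_apply, PiLp.single_apply, map_one, one_mul]
  split_ifs <;> ring

theorem metricMatrix_mulVec_radialVec (hx : x ≠ 0) :
    metricMatrix f x *ᵥ radialVec x = radialVec x := by
  rw [metricMatrix_eq hx, Matrix.add_mulVec, Matrix.smul_mulVec, Matrix.smul_mulVec,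
    Matrix.one_mulVec, Matrix.vecMulVec_mulVec, radialVec_dotProduct_self hx]
  ext i
  simp
  ring

/-- The eigenvalues are 1 (radial) and `(f ‖x‖ / ‖x‖) ^ 2` (tangential, `n - 1` times); the proof
uses the matrix determinant lemma. The outer square matches the root in `vol`. -/
theorem det_metricMatrix (hn : 1 ≤ n) (hx : x ≠ 0) (hf : f ‖x‖ ≠ 0) :
    (metricMatrix f x).det = ((f ‖x‖ / ‖x‖) ^ (n - 1)) ^ 2 := by
  have hc : (f ‖x‖ / ‖x‖) ^ 2 ≠ 0 := by
    have : ‖x‖ ≠ 0 := norm_ne_zero_iff.2 hx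
    positivity
  rw [metricMatrix_eq hx, ← pow_mul, mul_comm (n - 1), pow_mul]
  generalize (f ‖x‖ / ‖x‖) ^ 2 = c at *
  have h : c • (1 : Matrix (Fin n) (Fin n) ℝ) +
      (1 - c) • Matrix.vecMulVec (radialVec x) (radialVec x) =
      c • (1 + Matrix.replicateCol Unit ((c⁻¹ * (1 - c)) • radialVec x) *
        Matrix.replicateRow Unit (radialVec x)) := by
    ext i j
    simp [Matrix.vecMulVec_apply, Matrix.mul_apply]
    field_simp
  rw [h, Matrix.det_smul, Matrix.det_one_add_replicateCol_mul_replicateRow, dotProduct_smul,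
    radialVec_dotProduct_self hx, Fintype.card_fin]
  obtain ⟨m, rfl⟩ : ∃ m, n = m + 1 := ⟨n - 1, by omega⟩
  simp only [Nat.add_sub_cancel, smul_eq_mul, pow_succ]
  field_simp
  ring

/-- The matrix fixes the radial vector, hence so does its inverse, which need not be computed. -/
theorem covectorNorm_of_radial (hn : 1 ≤ n) (hx : x ≠ 0) (hf : f ‖x‖ ≠ 0)
    {α : EuclideanSpace ℝ (Fin n) →L[ℝ] ℝ} {k : ℝ}
    (hα : ∀ i, α (EuclideanSpace.single i 1) = k * radialVec x i) :
    covectorNorm f x α = |k| := by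
  have hdet : IsUnit (metricMatrix f x).det := by
    rw [det_metricMatrix hn hx hf, isUnit_iff_ne_zero]
    have : ‖x‖ ≠ 0 := norm_ne_zero_iff.2 hx
    positivity
  have h1 : (fun i => α (EuclideanSpace.single i 1)) = k • radialVec x := by
    ext i; simp [hα i]
  have h2 : (metricMatrix f x)⁻¹ *ᵥ radialVec x = radialVec x := by
    conv_lhs => rw [← metricMatrix_mulVec_radialVec (f := f) hx]
    rw [Matrix.mulVec_mulVec, Matrix.nonsing_inv_mul _ hdet, Matrix.one_mulVec]
  rw [covectorNorm, h1, Matrix.mulVec_smul, h2, dotProduct_smul, smul_dotProduct,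
    radialVec_dotProduct_self hx, smul_eq_mul, smul_eq_mul, mul_one, Real.sqrt_mul_self_eq_abs]

theorem covectorNorm_zero : covectorNorm f x 0 = 0 := by
  simp [covectorNorm]

theorem metric_smul_self {t : ℝ} (ht : 0 ≤ t) : metric f (t • x) x x = ‖x‖ ^ 2 := by
  by_cases h0 : t • x = 0
  · rw [metric, if_pos h0, real_inner_self_eq_norm_sq]
  · have hx : 0 < ‖x‖ := by
      rw [norm_pos_iff]; rintro rfl; simp at h0
    have ht' : 0 < t := ht.lt_of_ne (by rintro rfl; simp at h0)
    have hξ : ‖x‖ • ‖x‖⁻¹ • x = x := by rw [smul_smul, mul_inv_cancel₀ hx.ne', one_smul]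
    have := metric_polar f (t := t * ‖x‖) (by positivity) (ξ := ‖x‖⁻¹ • x) (η := 0) (η' := 0)
      (by rw [norm_smul, norm_inv, norm_norm, inv_mul_cancel₀ hx.ne']) (by simp) (by simp) ‖x‖ ‖x‖
    simpa [mul_smul, hξ, pow_two] using this

/-- The radial segment has constant speed `‖x‖`. The reverse inequality is not needed: from above,
geodesic balls are only compared with `carrier`. -/
theorem riemDist_zero_le (hx : ‖x‖ < l) : riemDist l f 0 x ≤ ENNReal.ofReal ‖x‖ := by
  have hd : ∀ t ∈ Icc (0 : ℝ) 1, derivWithin (fun t : ℝ => t • x) (Icc 0 1) t = x := by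
    intro t ht
    have : HasDerivAt (fun t : ℝ => t • x) x t := by
      simpa using (hasDerivAt_id t).smul_const x
    exact this.hasDerivWithinAt.derivWithin (uniqueDiffOn_Icc zero_lt_one t ht)
  have hlen : curveLength f (fun t : ℝ => t • x) = ENNReal.ofReal ‖x‖ := by
    rw [curveLength, setLIntegral_congr_fun (g := fun _ => ENNReal.ofReal ‖x‖) measurableSet_Icc]
    · simp
    · intro t ht
      simp only [hd t ht, metric_smul_self ht.1, Real.sqrt_sq (norm_nonneg x)]
  rw [← hlen]
  refine iInf_le_of_le (fun t : ℝ => t • x) (iInf_le_of_le ?_ (iInf_le_of_le (by simp)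
    (iInf_le_of_le (by simp) (iInf_le_of_le ?_ le_rfl))))
  · exact (contDiff_id.smul contDiff_const).contDiffOn
  · intro t ht
    rw [carrier, mem_ball_zero_iff, norm_smul, Real.norm_of_nonneg ht.1]
    nlinarith [ht.2, norm_nonneg x]

theorem ball_subset_geodesicBall {r : ℝ} (hr : r ≤ l) :
    Metric.ball 0 r ⊆ geodesicBall n l f r := by
  intro x hx
  rw [mem_ball_zero_iff] at hx
  have hl : ‖x‖ < l := hx.trans_le hr
  exact ⟨mem_ball_zero_iff.2 hl, (riemDist_zero_le hl).trans_lt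
    ((ENNReal.ofReal_lt_ofReal_iff ((norm_nonneg x).trans_lt hx)).2 hx)⟩

end

/-! ### The logarithmic cutoff -/

section

theorem exists_abs_deriv_smoothTransition_le :
    ∃ K : ℝ, 0 < K ∧ ∀ s, |deriv Real.smoothTransition s| ≤ K := by
  have hc : Continuous (deriv Real.smoothTransition) :=
    (Real.smoothTransition.contDiff (n := 1)).continuous_deriv le_rfl
  obtain ⟨K, hK⟩ := isCompact_Icc.exists_bound_of_continuousOn (s := Icc (0 : ℝ) 1) hc.continuousOn
  refine ⟨max K 1, by positivity, fun s => ?_⟩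
  by_cases hs : s ∈ Icc (0 : ℝ) 1
  · exact (hK s hs).trans (le_max_left _ _)
  have h0 : deriv Real.smoothTransition s = 0 := by
    rw [mem_Icc, not_and_or, not_le, not_le] at hs
    rcases hs with hs | hs
    · have : Real.smoothTransition =ᶠ[𝓝 s] fun _ => 0 := by
        filter_upwards [Iio_mem_nhds hs] with y hy using
          Real.smoothTransition.zero_of_nonpos (le_of_lt hy)
      rw [this.deriv_eq, deriv_const]
    · have : Real.smoothTransition =ᶠ[𝓝 s] fun _ => 1 := by
        filter_upwards [Ioi_mem_nhds hs] with y hy using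
          Real.smoothTransition.one_of_one_le (le_of_lt hy)
      rw [this.deriv_eq, deriv_const]
  rw [h0, abs_zero]
  positivity

/-- The smooth logarithmic cutoff on the line, `0` up to `a` and `1` from `b` on. -/
def logCutoff (a b s : ℝ) : ℝ :=
  -- `Real.log` is even, so without this test the cutoff would return to 1 for very negative `s`,
  -- that is, far outside the ball.
  if 0 < s then Real.smoothTransition (Real.log (s / a) / Real.log (b / a)) else 0

variable {a b s : ℝ}

theorem logCutoff_of_le (ha : 0 < a) (hab : a < b) (hs : s ≤ a) : logCutoff a b s = 0 := by
  unfold logCutoff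
  split_ifs with h
  · apply Real.smoothTransition.zero_of_nonpos
    apply div_nonpos_of_nonpos_of_nonneg
    · exact Real.log_nonpos (by positivity) ((div_le_one ha).2 hs)
    · exact Real.log_nonneg ((one_le_div ha).2 hab.le)
  · rfl

theorem logCutoff_of_ge (ha : 0 < a) (hab : a < b) (hs : b ≤ s) : logCutoff a b s = 1 := by
  have hb : 0 < b := ha.trans hab
  rw [logCutoff, if_pos (hb.trans_le hs)]
  apply Real.smoothTransition.one_of_one_le
  rw [one_le_div (Real.log_pos ((one_lt_div ha).2 hab))]
  exact Real.log_le_log (by positivity) (by gcongr)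

theorem logCutoff_nonneg : 0 ≤ logCutoff a b s := by
  unfold logCutoff
  split_ifs
  · exact Real.smoothTransition.nonneg _
  · rfl

theorem logCutoff_le_one : logCutoff a b s ≤ 1 := by
  unfold logCutoff
  split_ifs
  · exact Real.smoothTransition.le_one _
  · exact zero_le_one

theorem logCutoff_eventuallyEq_zero (ha : 0 < a) (hab : a < b) (hs : s < a) :
    logCutoff a b =ᶠ[𝓝 s] fun _ => 0 := by
  filter_upwards [Iio_mem_nhds hs] with y hy using logCutoff_of_le ha hab (le_of_lt hy)

theorem logCutoff_eventuallyEq_one (ha : 0 < a) (hab : a < b) (hs : b < s) :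
    logCutoff a b =ᶠ[𝓝 s] fun _ => 1 := by
  filter_upwards [Ioi_mem_nhds hs] with y hy using logCutoff_of_ge ha hab (le_of_lt hy)

theorem logCutoff_eventuallyEq (hs : 0 < s) : logCutoff a b =ᶠ[𝓝 s]
    fun y => Real.smoothTransition (Real.log (y / a) / Real.log (b / a)) := by
  filter_upwards [Ioi_mem_nhds hs] with y hy
  rw [logCutoff, if_pos (mem_Ioi.1 hy)]

theorem contDiff_logCutoff (ha : 0 < a) (hab : a < b) {m : ℕ∞} :
    ContDiff ℝ m (logCutoff a b) := by
  rw [contDiff_iff_contDiffAt]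
  intro s
  rcases lt_or_ge s a with hs | hs
  · exact contDiffAt_const.congr_of_eventuallyEq (logCutoff_eventuallyEq_zero ha hab hs)
  · have hs0 : 0 < s := ha.trans_le hs
    refine ContDiffAt.congr_of_eventuallyEq ?_ (logCutoff_eventuallyEq hs0)
    refine Real.smoothTransition.contDiffAt.comp s (ContDiffAt.div_const (ContDiffAt.log ?_ ?_) _)
    · exact contDiffAt_id.div_const a
    · exact (div_pos hs0 ha).ne'

theorem abs_deriv_logCutoff_le (ha : 0 < a) (hab : a < b) {K : ℝ}
    (hK : ∀ s, |deriv Real.smoothTransition s| ≤ K) (s : ℝ) :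
    |deriv (logCutoff a b) s| ≤ (Icc a b).indicator (fun s => K / Real.log (b / a) * s⁻¹) s := by
  by_cases hs : s ∈ Icc a b
  · have hs0 : 0 < s := ha.trans_le hs.1
    have hL : 0 < Real.log (b / a) := Real.log_pos ((one_lt_div ha).2 hab)
    have h1 : HasDerivAt (fun y => Real.log (y / a) / Real.log (b / a))
        (s⁻¹ / Real.log (b / a)) s := by
      have := ((hasDerivAt_id s).div_const a).log (div_pos hs0 ha).ne'
      refine (this.div_const (Real.log (b / a))).congr_deriv ?_
      simp only [id]
      field_simp
    have h2 : HasDerivAt Real.smoothTransition _ (Real.log (s / a) / Real.log (b / a)) :=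
      ((Real.smoothTransition.contDiff (n := 1)).differentiable one_ne_zero _).hasDerivAt
    have h3 := (h2.comp s h1).deriv
    rw [Function.comp_def] at h3
    rw [indicator_of_mem hs, (logCutoff_eventuallyEq hs0).deriv_eq, h3, abs_mul,
      abs_of_pos (show 0 < s⁻¹ / Real.log (b / a) by positivity)]
    calc _ ≤ K * (s⁻¹ / Real.log (b / a)) := by gcongr; exact hK _
      _ = _ := by ring
  · rw [indicator_of_notMem hs]
    rw [mem_Icc, not_and_or, not_le, not_le] at hs
    rcases hs with hs | hs
    · simp [(logCutoff_eventuallyEq_zero ha hab hs).deriv_eq]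
    · simp [(logCutoff_eventuallyEq_one ha hab hs).deriv_eq]

/-! ### The cutoff as a radial test function -/

variable {n : ℕ} {l : ℝ} {x : EuclideanSpace ℝ (Fin n)}

theorem hasFDerivAt_norm_of_ne_zero (hx : x ≠ 0) :
    HasFDerivAt (fun y : EuclideanSpace ℝ (Fin n) => ‖y‖) (‖x‖⁻¹ • innerSL ℝ x) x := by
  have hn : ‖x‖ ≠ 0 := norm_ne_zero_iff.2 hx
  have := (hasStrictFDerivAt_norm_sq x).hasFDerivAt.sqrt (by positivity)
  simp only [Real.sqrt_sq (norm_nonneg _)] at this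
  refine this.congr_fderiv ?_
  ext v
  simp
  field_simp

/-- The radial logarithmic cutoff near the boundary of the ball of radius `l`. -/
def radialCutoff (n : ℕ) (l a b : ℝ) (x : EuclideanSpace ℝ (Fin n)) : ℝ :=
  logCutoff a b (l - ‖x‖)

theorem radialCutoff_eventuallyEq_one (ha : 0 < a) (hab : a < b) (hx : ‖x‖ < l - b) :
    radialCutoff n l a b =ᶠ[𝓝 x] fun _ => 1 := by
  have : ∀ᶠ y in 𝓝 x, ‖y‖ < l - b := continuous_norm.continuousAt.eventually_lt_const hx
  filter_upwards [this] with y hy using logCutoff_of_ge ha hab (by linarith)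

/-- The norm is not smooth at the origin, but `b < l` makes the cutoff constant there. -/
theorem contDiff_radialCutoff (ha : 0 < a) (hab : a < b) (hbl : b < l) {m : ℕ∞} :
    ContDiff ℝ m (radialCutoff n l a b) := by
  rw [contDiff_iff_contDiffAt]
  intro x
  by_cases hx : x = 0
  · exact contDiffAt_const.congr_of_eventuallyEq
      (radialCutoff_eventuallyEq_one ha hab (by simp [hx, hbl]))
  · exact (contDiff_logCutoff ha hab).contDiffAt.comp x (contDiffAt_const.sub (contDiffAt_norm ℝ hx))

theorem tsupport_radialCutoff_subset (ha : 0 < a) (hab : a < b) :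
    tsupport (radialCutoff n l a b) ⊆ Metric.closedBall 0 (l - a) := by
  refine closure_minimal (fun x hx => ?_) Metric.isClosed_closedBall
  rw [mem_closedBall_zero_iff]
  by_contra! h
  exact hx (logCutoff_of_le ha hab (by linarith))

theorem isTestFunction_radialCutoff (ha : 0 < a) (hab : a < b) (hbl : b < l)
    {Ω : Set (EuclideanSpace ℝ (Fin n))} (hΩ : Metric.closedBall 0 (l - a) ⊆ Ω) :
    IsTestFunction Ω (radialCutoff n l a b) :=
  ⟨contDiff_radialCutoff ha hab hbl,
    HasCompactSupport.intro' (isCompact_closedBall 0 (l - a)) Metric.isClosed_closedBall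
      fun _ hx => image_eq_zero_of_notMem_tsupport fun h => hx (tsupport_radialCutoff_subset ha hab h),
    (tsupport_radialCutoff_subset ha hab).trans hΩ⟩

theorem covectorNorm_fderiv_radialCutoff {f : ℝ → ℝ} (hn : 1 ≤ n) (ha : 0 < a) (hab : a < b)
    (hbl : b < l) (hf : x ≠ 0 → f ‖x‖ ≠ 0) :
    covectorNorm f x (fderiv ℝ (radialCutoff n l a b) x) = |deriv (logCutoff a b) (l - ‖x‖)| := by
  by_cases hx : x = 0
  · subst hx
    rw [(radialCutoff_eventuallyEq_one ha hab (by simp [hbl])).fderiv_eq, fderiv_fun_const,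
      Pi.zero_apply, covectorNorm_zero, norm_zero, sub_zero,
      (logCutoff_eventuallyEq_one ha hab hbl).deriv_eq, deriv_const, abs_zero]
  · have h1 : HasDerivAt (logCutoff a b) (deriv (logCutoff a b) (l - ‖x‖)) (l - ‖x‖) :=
      ((contDiff_logCutoff ha hab (m := 1)).differentiable one_ne_zero _).hasDerivAt
    have h2 : HasFDerivAt (fun y : EuclideanSpace ℝ (Fin n) => l - ‖y‖) (-(‖x‖⁻¹ • innerSL ℝ x)) x :=
      (hasFDerivAt_norm_of_ne_zero hx).const_sub l
    have h3 : HasFDerivAt (radialCutoff n l a b) _ x := h1.comp_hasFDerivAt x h2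
    -- The cutoff is a function of `l - ‖x‖`, so the radial coefficient is minus its derivative.
    rw [h3.fderiv, ← abs_neg]
    refine covectorNorm_of_radial hn hx (hf hx) fun i => ?_
    simp [radialVec, EuclideanSpace.inner_single_right]

end

/-! ### Volume and energy in polar coordinates -/

section

variable {n : ℕ} {f : ℝ → ℝ} {l a b C : ℝ}

theorem vol_restrict_ball (hn : 1 ≤ n) (hpos : ∀ t ∈ Ioo 0 l, 0 < f t) :
    (vol n f).restrict (Metric.ball 0 l) = (volume.restrict (Metric.ball 0 l)).withDensity
      fun x : EuclideanSpace ℝ (Fin n) => ENNReal.ofReal ((f ‖x‖ / ‖x‖) ^ (n - 1)) := by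
  have : Nonempty (Fin n) := ⟨⟨0, hn⟩⟩
  rw [vol, restrict_withDensity Metric.isOpen_ball.measurableSet]
  refine withDensity_congr_ae ?_
  have h0 : ∀ᵐ x : EuclideanSpace ℝ (Fin n) ∂volume.restrict (Metric.ball 0 l), x ≠ 0 :=
    ae_restrict_of_ae (compl_mem_ae_iff.2 (measure_singleton 0))
  filter_upwards [h0, ae_restrict_mem Metric.isOpen_ball.measurableSet] with x hx hxl
  rw [mem_ball_zero_iff] at hxl
  have hx' : 0 < ‖x‖ := norm_pos_iff.2 hx
  have hf := hpos _ ⟨hx', hxl⟩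
  rw [det_metricMatrix hn hx hf.ne', Real.sqrt_sq (by positivity)]

theorem vol_ball_lt_top (hn : 1 ≤ n) (hpos : ∀ t ∈ Ioo 0 l, 0 < f t) (hC : 0 ≤ C)
    (hCf : ∀ t ∈ Ioo 0 l, f t ≤ C * t) (hf0 : f 0 = 0) : vol n f (Metric.ball 0 l) < ∞ := by
  rw [← Measure.restrict_apply_univ, vol_restrict_ball hn hpos, withDensity_apply _ MeasurableSet.univ,
    Measure.restrict_univ]
  calc _ ≤ ∫⁻ x : EuclideanSpace ℝ (Fin n) in Metric.ball 0 l, ENNReal.ofReal (C ^ (n - 1)) := by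
        refine setLIntegral_mono measurable_const fun x hx => ENNReal.ofReal_le_ofReal ?_
        rw [mem_ball_zero_iff] at hx
        rcases (norm_nonneg x).eq_or_lt with h | h
        · rw [← h, hf0, zero_div]
          exact pow_le_pow_left₀ le_rfl hC _
        · have := hpos _ ⟨h, hx⟩
          refine pow_le_pow_left₀ (by positivity) ?_ _
          rw [div_le_iff₀ h]
          exact hCf _ ⟨h, hx⟩
    _ < ∞ := by
        rw [setLIntegral_const]
        exact ENNReal.mul_lt_top ENNReal.ofReal_lt_top measure_ball_lt_top

theorem vol_ball_pos (hn : 1 ≤ n) (hl : 0 < l) (hpos : ∀ t ∈ Ioo 0 l, 0 < f t)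
    (hf : ContinuousOn f (Ioo 0 l)) : 0 < vol n f (Metric.ball 0 l) := by
  have : Nonempty (Fin n) := ⟨⟨0, hn⟩⟩
  set S : Set (EuclideanSpace ℝ (Fin n)) := Metric.ball 0 l \ {0}
  have hS : IsOpen S := Metric.isOpen_ball.sdiff isClosed_singleton
  have hSm : ∀ x ∈ S, ‖x‖ ∈ Ioo 0 l := fun x hx =>
    ⟨norm_pos_iff.2 hx.2, mem_ball_zero_iff.1 hx.1⟩
  have hcont : ContinuousOn (fun x : EuclideanSpace ℝ (Fin n) =>
      ENNReal.ofReal ((f ‖x‖ / ‖x‖) ^ (n - 1))) S :=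
    ENNReal.continuous_ofReal.comp_continuousOn (((hf.comp continuous_norm.continuousOn hSm).div
      continuous_norm.continuousOn fun x hx => (hSm x hx).1.ne').pow _)
  have hvol : volume S ≠ 0 := by
    rw [measure_sdiff_null (measure_singleton 0)]
    exact (Metric.measure_ball_pos volume 0 hl).ne'
  rw [← Measure.restrict_apply_univ, vol_restrict_ball hn hpos, withDensity_apply _ MeasurableSet.univ,
    Measure.restrict_univ, pos_iff_ne_zero]
  intro h
  have h' : ∫⁻ x in S, ENNReal.ofReal ((f ‖x‖ / ‖x‖) ^ (n - 1)) = 0 :=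
    le_antisymm ((lintegral_mono_set sdiff_subset).trans h.le) bot_le
  rw [lintegral_eq_zero_iff' (hcont.aemeasurable hS.measurableSet)] at h'
  apply hvol
  have h2 : ∀ᵐ x ∂volume.restrict S, False := by
    filter_upwards [h', ae_restrict_mem hS.measurableSet] with x hx hxS
    have h1 := hpos _ (hSm x hxS)
    have h3 := (hSm x hxS).1
    have : 0 < (f ‖x‖ / ‖x‖) ^ (n - 1) := by positivity
    simp only [Pi.zero_apply, ENNReal.ofReal_eq_zero] at hx
    linarith
  rw [← Measure.restrict_apply_univ]
  simpa [ae_iff] using h2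

/-- In polar coordinates, the reciprocal distance to the sphere of radius `l` has logarithmic
integral over a shell, when normalised by the area of the spheres. -/
theorem lintegral_shell_eq (hn : 1 ≤ n) (ha : 0 < a) (hab : a < b) (hbl : b < l) :
    ∫⁻ x : EuclideanSpace ℝ (Fin n), ENNReal.ofReal
        ((Icc (l - b) (l - a)).indicator (fun y => (y ^ (n - 1))⁻¹ * (l - y)⁻¹) ‖x‖) =
      ENNReal.ofReal (n * (volume.real (Metric.ball (0 : EuclideanSpace ℝ (Fin n)) 1) *
        Real.log (b / a))) := by
  have : Nonempty (Fin n) := ⟨⟨0, hn⟩⟩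
  set h : ℝ → ℝ := (Icc (l - b) (l - a)).indicator (fun y => (y ^ (n - 1))⁻¹ * (l - y)⁻¹)
  -- The weight `(y ^ (n - 1))⁻¹` cancels the polar Jacobian, leaving the integral of `(l - y)⁻¹`.
  have hh : (fun y : ℝ => y ^ (n - 1) • h y) =
      (Icc (l - b) (l - a)).indicator fun y => (l - y)⁻¹ := by
    ext y
    by_cases hy : y ∈ Icc (l - b) (l - a)
    · have : 0 < y := by linarith [hy.1]
      simp only [h, indicator_of_mem hy, smul_eq_mul]
      field_simp
    · simp only [h, indicator_of_notMem hy, smul_zero]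
  have hcont : ContinuousOn (fun y : ℝ => (l - y)⁻¹) (Icc (l - b) (l - a)) :=
    (continuousOn_const.sub continuousOn_id).inv₀ fun y hy =>
      (show (0 : ℝ) < l - y by linarith [hy.2]).ne'
  have hint : Integrable (fun x : EuclideanSpace ℝ (Fin n) => h ‖x‖) := by
    rw [integrable_fun_norm_addHaar volume, finrank_euclideanSpace_fin, hh]
    exact ((integrable_indicator_iff measurableSet_Icc).2
      (hcont.integrableOn_compact isCompact_Icc)).integrableOn
  have hnn : 0 ≤ᵐ[volume] fun x : EuclideanSpace ℝ (Fin n) => h ‖x‖ :=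
    Eventually.of_forall fun x => indicator_nonneg (fun y hy => by
      have h1 : 0 < y := by linarith [hy.1]
      have h2 : 0 < l - y := by linarith [hy.2]
      positivity) _
  rw [← ofReal_integral_eq_lintegral_ofReal hint hnn, integral_fun_norm_addHaar volume h,
    finrank_euclideanSpace_fin, hh, setIntegral_indicator measurableSet_Icc,
    inter_eq_self_of_subset_right (fun y hy => by simp only [mem_Ioi]; linarith [hy.1]),
    integral_Icc_eq_integral_Ioc, ← intervalIntegral.integral_of_le (by linarith),
    intervalIntegral.integral_comp_sub_left (fun y => y⁻¹) l, sub_sub_cancel, sub_sub_cancel,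
    integral_inv_of_pos ha (ha.trans hab), nsmul_eq_mul, smul_eq_mul]

/-- The `p`-energy of the logarithmic cutoff. -/
theorem lintegral_deriv_logCutoff_le (hn : 1 ≤ n) (ha : 0 < a) (hab : a < b) (hbl : b < l)
    (hpos : ∀ t ∈ Ioo 0 l, 0 < f t) (hC : 0 ≤ C) (hCf : ∀ t ∈ Ioo 0 l, f t ≤ C * (l - t)) {p K : ℝ}
    (hp : 1 < p) (hpn : p ≤ n) (hK0 : 0 < K) (hK : ∀ s, |deriv Real.smoothTransition s| ≤ K) :
    ∫⁻ x in Metric.ball (0 : EuclideanSpace ℝ (Fin n)) l,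
        ENNReal.ofReal (|deriv (logCutoff a b) (l - ‖x‖)| ^ p) ∂vol n f ≤
      ENNReal.ofReal (K ^ p * C ^ (n - 1) * l ^ ((n : ℝ) - p) * Real.log (b / a) ^ (-p)) *
        ENNReal.ofReal (n * (volume.real (Metric.ball (0 : EuclideanSpace ℝ (Fin n)) 1) *
          Real.log (b / a))) := by
  have hL : 0 < Real.log (b / a) := Real.log_pos ((one_lt_div ha).2 hab)
  have hl : 0 < l := ha.trans (hab.trans hbl)
  set Q := K ^ p * C ^ (n - 1) * l ^ ((n : ℝ) - p) * Real.log (b / a) ^ (-p) with hQ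
  have hQ0 : 0 ≤ Q := by positivity
  set S := Metric.ball (0 : EuclideanSpace ℝ (Fin n)) l
  have hSm : MeasurableSet S := Metric.isOpen_ball.measurableSet
  set G : EuclideanSpace ℝ (Fin n) → ℝ≥0∞ :=
    fun x => ENNReal.ofReal ((C * (l - ‖x‖) / ‖x‖) ^ (n - 1))
  have hG : Measurable G := by fun_prop
  -- The majorant `G` is measurable on the whole space, so no measurability of `f` is required.
  have hmu : (vol n f).restrict S ≤ (volume.restrict S).withDensity G := by
    rw [vol_restrict_ball hn hpos]
    refine withDensity_mono ?_
    have : Nonempty (Fin n) := ⟨⟨0, hn⟩⟩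
    have h0 : ∀ᵐ x : EuclideanSpace ℝ (Fin n) ∂volume.restrict S, x ≠ 0 :=
      ae_restrict_of_ae (compl_mem_ae_iff.2 (measure_singleton 0))
    filter_upwards [h0, ae_restrict_mem hSm] with x hx hxl
    rw [mem_ball_zero_iff] at hxl
    have hx' : 0 < ‖x‖ := norm_pos_iff.2 hx
    have hf := hpos _ ⟨hx', hxl⟩
    exact ENNReal.ofReal_le_ofReal (pow_le_pow_left₀ (by positivity)
      (div_le_div_of_nonneg_right (hCf _ ⟨hx', hxl⟩) hx'.le) _)
  have hmeas : Measurable fun x : EuclideanSpace ℝ (Fin n) =>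
      ENNReal.ofReal (|deriv (logCutoff a b) (l - ‖x‖)| ^ p) := by
    have : Measurable (deriv (logCutoff a b)) := measurable_deriv _
    fun_prop
  calc _ ≤ ∫⁻ x, ENNReal.ofReal (|deriv (logCutoff a b) (l - ‖x‖)| ^ p)
          ∂(volume.restrict S).withDensity G := lintegral_mono' hmu le_rfl
    _ = ∫⁻ x in S, G x * ENNReal.ofReal (|deriv (logCutoff a b) (l - ‖x‖)| ^ p) :=
        lintegral_withDensity_eq_lintegral_mul _ hG hmeas
    _ ≤ ∫⁻ x in S, ENNReal.ofReal Q * ENNReal.ofReal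
          ((Icc (l - b) (l - a)).indicator (fun y => (y ^ (n - 1))⁻¹ * (l - y)⁻¹) ‖x‖) := by
        refine setLIntegral_mono' hSm fun x hx => ?_
        rw [mem_ball_zero_iff] at hx
        have hs : 0 < l - ‖x‖ := by linarith
        rw [← ENNReal.ofReal_mul hQ0, ← ENNReal.ofReal_mul (by positivity)]
        refine ENNReal.ofReal_le_ofReal ?_
        have hd := abs_deriv_logCutoff_le ha hab hK (l - ‖x‖)
        by_cases hx2 : ‖x‖ ∈ Icc (l - b) (l - a)
        · have hs2 : l - ‖x‖ ∈ Icc a b := ⟨by linarith [hx2.2], by linarith [hx2.1]⟩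
          have hx0 : 0 < ‖x‖ := by linarith [hx2.1]
          rw [indicator_of_mem hs2] at hd
          rw [indicator_of_mem hx2]
          generalize ‖x‖ = y at *
          calc (C * (l - y) / y) ^ (n - 1) * |deriv (logCutoff a b) (l - y)| ^ p
              ≤ (C * (l - y) / y) ^ (n - 1) * (K / Real.log (b / a) * (l - y)⁻¹) ^ p := by
                gcongr
            _ = K ^ p * C ^ (n - 1) * (l - y) ^ ((n : ℝ) - p) * Real.log (b / a) ^ (-p) *
                  ((y ^ (n - 1))⁻¹ * (l - y)⁻¹) := by
                have e1 : (l - y) ^ ((n : ℝ) - p) = (l - y) ^ (n - 1) * (l - y) * ((l - y) ^ p)⁻¹ := by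
                  rw [Real.rpow_sub hs, Real.rpow_natCast, ← pow_succ, Nat.sub_add_cancel hn,
                    div_eq_mul_inv]
                rw [e1, Real.mul_rpow (by positivity) (by positivity),
                  Real.div_rpow hK0.le hL.le, Real.inv_rpow hs.le, Real.rpow_neg hL.le, div_pow,
                  mul_pow]
                have := Real.rpow_pos_of_pos hs p
                have := Real.rpow_pos_of_pos hL p
                field_simp
            -- Here `p ≤ n` enters: `(l - y) ^ (n - p)` is increasing in `l - y ≤ l`.
            _ ≤ Q * ((y ^ (n - 1))⁻¹ * (l - y)⁻¹) := by
                rw [hQ]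
                gcongr
                linarith
        · have hs2 : l - ‖x‖ ∉ Icc a b := fun h => hx2 ⟨by linarith [h.2], by linarith [h.1]⟩
          rw [indicator_of_notMem hs2] at hd
          rw [indicator_of_notMem hx2, le_antisymm hd (abs_nonneg _),
            Real.zero_rpow (by linarith), mul_zero, mul_zero]
    _ ≤ ∫⁻ x : EuclideanSpace ℝ (Fin n), ENNReal.ofReal Q * ENNReal.ofReal
          ((Icc (l - b) (l - a)).indicator (fun y => (y ^ (n - 1))⁻¹ * (l - y)⁻¹) ‖x‖) :=
        lintegral_mono' Measure.restrict_le_self le_rfl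
    _ = _ := by rw [lintegral_const_mul' _ _ ENNReal.ofReal_ne_top,
          lintegral_shell_eq hn ha hab hbl]

end

/-! ### Rayleigh quotient and limit -/

section

variable {n : ℕ} {f : ℝ → ℝ} {l a b C : ℝ}

/-- A test function is an admissible competitor for the first eigenvalue. -/
theorem memW0_of_isTestFunction {p : ℝ} (hp : 0 < p) {Ω : Set (EuclideanSpace ℝ (Fin n))}
    {φ : EuclideanSpace ℝ (Fin n) → ℝ} (hφ : IsTestFunction Ω φ)
    (hfin : sobolevEnergy f p Ω φ (fderiv ℝ φ) < ∞) : MemW0 f p Ω φ (fderiv ℝ φ) := by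
  refine ⟨hφ.1.continuous.aestronglyMeasurable,
    (hφ.1.continuous_fderiv (by simp)).aestronglyMeasurable, hfin, fun _ => φ, fun _ => hφ, ?_⟩
  simp [sobolevEnergy, covectorNorm_zero, Real.zero_rpow hp.ne']

/-- The radial cutoff is the competitor: `l - a < r` puts its support inside the geodesic ball, and
its plateau gives the denominator. -/
theorem firstEigenvalue_geodesicBall_le (hn : 1 ≤ n) {r p K : ℝ} (hr : r ≤ l) (ha : 0 < a)
    (hab : a < b) (hbl : b < l) (har : l - a < r) (hpos : ∀ t ∈ Ioo 0 l, 0 < f t)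
    (hf : ContinuousOn f (Ioo 0 l)) (hf0 : f 0 = 0) (hC : 0 ≤ C)
    (hCf : ∀ t ∈ Ioo 0 l, f t ≤ C * t) (hCf' : ∀ t ∈ Ioo 0 l, f t ≤ C * (l - t))
    (hp : 1 < p) (hpn : p ≤ n) (hK0 : 0 < K) (hK : ∀ s, |deriv Real.smoothTransition s| ≤ K) :
    firstEigenvalue f p (geodesicBall n l f r) ≤
      ENNReal.ofReal (K ^ p * C ^ (n - 1) * l ^ ((n : ℝ) - p) *
        (n * volume.real (Metric.ball (0 : EuclideanSpace ℝ (Fin n)) 1)) *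
          Real.log (b / a) ^ (1 - p)) / vol n f (Metric.ball 0 (l - b)) := by
  have hL : 0 < Real.log (b / a) := Real.log_pos ((one_lt_div ha).2 hab)
  have hl : 0 < l := ha.trans (hab.trans hbl)
  set Ω := geodesicBall n l f r
  set φ := radialCutoff n l a b
  have hball : Metric.closedBall 0 (l - a) ⊆ Ω :=
    (Metric.closedBall_subset_ball har).trans (ball_subset_geodesicBall hr)
  have hΩ : Ω ⊆ Metric.ball 0 l := fun x hx => hx.1
  have hφ : IsTestFunction Ω φ := isTestFunction_radialCutoff ha hab hbl hball
  have hden : vol n f (Metric.ball 0 (l - b)) ≤ ∫⁻ x in Ω, ENNReal.ofReal (|φ x| ^ p) ∂vol n f := by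
    rw [← setLIntegral_one]
    calc _ = ∫⁻ x in Metric.ball 0 (l - b), ENNReal.ofReal (|φ x| ^ p) ∂vol n f := by
          refine setLIntegral_congr_fun Metric.isOpen_ball.measurableSet fun x hx => ?_
          rw [mem_ball_zero_iff] at hx
          have : φ x = 1 := logCutoff_of_ge ha hab (by linarith)
          simp [this]
      _ ≤ _ := lintegral_mono_set
          ((Metric.ball_subset_closedBall.trans (Metric.closedBall_subset_closedBall
            (by linarith))).trans hball)
  have hvolpos : 0 < vol n f (Metric.ball 0 (l - b)) :=
    vol_ball_pos hn (by linarith) (fun t ht => hpos t ⟨ht.1, by linarith [ht.2]⟩)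
      (hf.mono (Ioo_subset_Ioo_right (by linarith)))
  have hnum : ∫⁻ x in Ω, ENNReal.ofReal (covectorNorm f x (fderiv ℝ φ x) ^ p) ∂vol n f ≤
      ENNReal.ofReal (K ^ p * C ^ (n - 1) * l ^ ((n : ℝ) - p) *
        (n * volume.real (Metric.ball (0 : EuclideanSpace ℝ (Fin n)) 1)) *
          Real.log (b / a) ^ (1 - p)) := by
    calc _ ≤ ∫⁻ x in Metric.ball 0 l, ENNReal.ofReal (covectorNorm f x (fderiv ℝ φ x) ^ p) ∂vol n f :=
          lintegral_mono_set hΩ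
      _ = ∫⁻ x in Metric.ball (0 : EuclideanSpace ℝ (Fin n)) l,
            ENNReal.ofReal (|deriv (logCutoff a b) (l - ‖x‖)| ^ p) ∂vol n f := by
          refine setLIntegral_congr_fun Metric.isOpen_ball.measurableSet fun x hx => ?_
          rw [mem_ball_zero_iff] at hx
          simp only [φ]
          rw [covectorNorm_fderiv_radialCutoff hn ha hab hbl
            fun h => (hpos _ ⟨norm_pos_iff.2 h, hx⟩).ne']
      _ ≤ _ := lintegral_deriv_logCutoff_le hn ha hab hbl hpos hC hCf' hp hpn hK0 hK
      _ = _ := by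
          rw [← ENNReal.ofReal_mul (by positivity)]
          congr 1
          rw [sub_eq_add_neg 1 p, Real.rpow_add hL, Real.rpow_one]
          ring
  have hfin : sobolevEnergy f p Ω φ (fderiv ℝ φ) < ∞ := by
    rw [sobolevEnergy, lintegral_add_left
      ((hφ.1.continuous.abs.rpow_const fun _ => Or.inr (by linarith)).measurable.ennreal_ofReal)]
    refine ENNReal.add_lt_top.2 ⟨?_, hnum.trans_lt ENNReal.ofReal_lt_top⟩
    calc _ ≤ ∫⁻ x in Metric.ball 0 l, ENNReal.ofReal (|φ x| ^ p) ∂vol n f := lintegral_mono_set hΩ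
      _ ≤ ∫⁻ x in Metric.ball 0 l, 1 ∂vol n f := by
          refine lintegral_mono fun x => ENNReal.ofReal_le_one.2 ?_
          exact Real.rpow_le_one (abs_nonneg _)
            ((abs_of_nonneg logCutoff_nonneg).trans_le logCutoff_le_one) (by linarith)
      _ < ∞ := by
          rw [setLIntegral_one]
          exact vol_ball_lt_top hn hpos hC hCf hf0
  have hne : ¬ φ =ᵐ[(vol n f).restrict Ω] 0 := by
    intro h
    have h0 : ∫⁻ x in Ω, ENNReal.ofReal (|φ x| ^ p) ∂vol n f = 0 := by
      rw [lintegral_congr_ae (g := fun _ => 0), lintegral_zero]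
      filter_upwards [h] with x hx
      simp [hx, Real.zero_rpow (show p ≠ 0 by linarith)]
    exact (hvolpos.trans_le hden).ne' h0
  calc firstEigenvalue f p Ω ≤ (∫⁻ x in Ω, ENNReal.ofReal (covectorNorm f x (fderiv ℝ φ x) ^ p) ∂vol n f) /
        ∫⁻ x in Ω, ENNReal.ofReal (|φ x| ^ p) ∂vol n f := by
        exact iInf_le_of_le φ (iInf_le_of_le (fderiv ℝ φ) (iInf_le_of_le
        (memW0_of_isTestFunction (by linarith) hφ hfin) (iInf_le_of_le hne le_rfl)))
    _ ≤ _ := ENNReal.div_le_div hnum hden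

/-- If the warping function is `C¹` up to the closing end, then the first eigenvalues of the balls
`B(q, r)` tend to zero for all exponents up to the dimension. -/
theorem tendsto_firstEigenvalue_geodesicBall (hn : 1 ≤ n) (hl : 0 < l) (hf0 : f 0 = 0)
    (hpos : ∀ t ∈ Ioo 0 l, 0 < f t) (hclose : f l = 0) (hf : ContDiffOn ℝ 1 f (Icc 0 l)) {p : ℝ}
    (hp : 1 < p) (hpn : p ≤ n) :
    Tendsto (fun r => firstEigenvalue f p (geodesicBall n l f r)) (𝓝[<] l) (𝓝 0) := by
  obtain ⟨C, hC⟩ := hf.exists_lipschitzOnWith one_ne_zero (convex_Icc 0 l) isCompact_Icc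
  have hCf : ∀ t ∈ Ioo 0 l, f t ≤ C * t := fun t ht => by
    have := hC.dist_le_mul t (Ioo_subset_Icc_self ht) 0 (left_mem_Icc.2 hl.le)
    rw [Real.dist_eq, Real.dist_eq, hf0, sub_zero, sub_zero, abs_of_pos ht.1] at this
    exact (le_abs_self _).trans this
  have hCf' : ∀ t ∈ Ioo 0 l, f t ≤ C * (l - t) := fun t ht => by
    have := hC.dist_le_mul t (Ioo_subset_Icc_self ht) l (right_mem_Icc.2 hl.le)
    rw [Real.dist_eq, dist_comm, Real.dist_eq, hclose, sub_zero,
      abs_of_pos (sub_pos.2 ht.2)] at this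
    exact (le_abs_self _).trans this
  obtain ⟨K, hK0, hK⟩ := exists_abs_deriv_smoothTransition_le
  have hvol : vol n f (Metric.ball 0 (l - l / 2)) ≠ 0 :=
    (vol_ball_pos hn (by linarith) (fun t ht => hpos t ⟨ht.1, by linarith [ht.2]⟩)
      (hf.continuousOn.mono (Ioo_subset_Icc_self.trans (Icc_subset_Icc_right (by linarith))))).ne'
  set Q := K ^ p * (C : ℝ) ^ (n - 1) * l ^ ((n : ℝ) - p) *
    (n * volume.real (Metric.ball (0 : EuclideanSpace ℝ (Fin n)) 1))
  -- The choice is `b = l / 2` and `a = 2 * (l - r)`; the factor 2 makes `l - a < r` strict.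
  have hlim : Tendsto (fun r => ENNReal.ofReal (Q * Real.log (l / 2 / (2 * (l - r))) ^ (1 - p)) /
      vol n f (Metric.ball 0 (l - l / 2))) (𝓝[<] l) (𝓝 0) := by
    have h1 : Tendsto (fun r => 2 * (l - r)) (𝓝[<] l) (𝓝[>] 0) := by
      refine tendsto_nhdsWithin_iff.2 ⟨?_, ?_⟩
      · have : Continuous fun r : ℝ => 2 * (l - r) := by fun_prop
        simpa using (this.tendsto l).mono_left nhdsWithin_le_nhds
      · filter_upwards [self_mem_nhdsWithin] with r hr
        have : r < l := hr
        simp only [mem_Ioi]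
        linarith
    have h2 : Tendsto (fun r => l / 2 / (2 * (l - r))) (𝓝[<] l) atTop := by
      simp only [div_eq_mul_inv (l / 2)]
      exact (tendsto_inv_nhdsGT_zero.comp h1).const_mul_atTop (by linarith)
    have h3 := (tendsto_rpow_neg_atTop (show 0 < p - 1 by linarith)).comp
      (Real.tendsto_log_atTop.comp h2)
    simp only [neg_sub] at h3
    have h4 := (ENNReal.continuous_ofReal.tendsto _).comp (h3.const_mul Q)
    rw [mul_zero, ENNReal.ofReal_zero] at h4
    have h5 := ENNReal.Tendsto.div_const h4 (Or.inr hvol)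
    rwa [ENNReal.zero_div] at h5
  refine tendsto_of_tendsto_of_tendsto_of_le_of_le' tendsto_const_nhds hlim
    (Eventually.of_forall fun _ => bot_le) ?_
  -- `r > l - l / 4` is exactly `a < b`.
  filter_upwards [Ioo_mem_nhdsLT (show l - l / 4 < l by linarith)] with r hr
  exact firstEigenvalue_geodesicBall_le hn hr.2.le (by linarith [hr.2]) (by linarith [hr.1])
    (by linarith) (by linarith [hr.2]) hpos (hf.continuousOn.mono Ioo_subset_Icc_self) hf0 C.2
    hCf hCf' hp hpn hK0 hK

end

end SpaceForm

end

theorem lemma2p1 (n : ℕ) (l : ℝ) (hl : 0 < l) (f : ℝ → ℝ)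
    (hf : ContDiffOn ℝ 2 f (Set.Ico 0 l))
    (hf3 : ContDiffWithinAt ℝ 3 f (Set.Ici 0) 0)
    (hf0 : f 0 = 0)
    (hf0' : derivWithin f (Set.Ici 0) 0 = 1)
    (hf0'' : iteratedDerivWithin 2 f (Set.Ici 0) 0 = 0)
    (hpos : ∀ t ∈ Set.Ioo 0 l, 0 < f t)
    (hclose : f l = 0) :
    (n = 2 → (∃ ε > 0, ContDiffOn ℝ 1 f (Set.Ico 0 (l + ε))) →
      ∀ p : ℝ, 1 < p → p ≤ 2 →
        Filter.Tendsto
          (fun r => SpaceForm.firstEigenvalue f p (SpaceForm.geodesicBall n l f r))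
          (nhdsWithin l (Set.Iio l)) (nhds 0)) ∧
    (3 ≤ n → (∃ ε > 0, ContDiffOn ℝ 2 f (Set.Ico 0 (l + ε))) →
      ∀ p : ℝ, 1 < p → p < 3 →
        Filter.Tendsto
          (fun r => SpaceForm.firstEigenvalue f p (SpaceForm.geodesicBall n l f r))
          (nhdsWithin l (Set.Iio l)) (nhds 0)) := by
  -- Regularity past `l` is used only to reach the closed interval, where `C¹` implies Lipschitz.
  have key : ∀ ε > 0, ContDiffOn ℝ 1 f (Set.Ico 0 (l + ε)) → ContDiffOn ℝ 1 f (Set.Icc 0 l) :=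
    fun ε hε h => h.mono fun t ht => ⟨ht.1, by linarith [ht.2]⟩
  refine ⟨?_, ?_⟩
  · rintro rfl ⟨ε, hε, h⟩ p hp hp2
    exact SpaceForm.tendsto_firstEigenvalue_geodesicBall (by norm_num) hl hf0 hpos hclose
      (key ε hε h) hp (by exact_mod_cast hp2)
  · rintro hn ⟨ε, hε, h⟩ p hp hp3
    have hn3 : (3 : ℝ) ≤ n := by exact_mod_cast hn
    exact SpaceForm.tendsto_firstEigenvalue_geodesicBall (by omega) hl hf0 hpos hclose
      (key ε hε (h.of_le (by norm_num))) hp (by linarith)
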